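/- Let $P>0$, $\nu\in(0,1)$ and $P_{\mathrm{oe}}\in(0,1]$. Let $p(y|x)$ be a memoryless channel with real input and arbitrary (measurable) output alphabet $\mathcal Y$, and let $(\mathsf x_1,\mathsf y_1),(\mathsf x_2,\mathsf y_2),\dots$ be i.i.d. copies of $(\mathsf x,\mathsf y)$, where $\mathsf x\sim\mathcal N(0,P)$ and $\mathsf y$ is the channel output for the input $\mathsf x$. The training data set of length $L$ is $\mathcal T=\{(\mathsf x_1,\mathsf y_1),\dots,(\mathsf x_L,\mathsf y_L)\}$. Put $n=\lfloor\nu L\rfloor$ and split $\mathcal T$ into a learning part of length $L-n$ and a held-out part of length $n$. A learning rule produces, for every $L$ and measurably from the learning part only, a function $g_{\mathcal T}:\mathcal Y\to\mathbb R$ and a number $a_{\mathcal T}\in\mathbb R$. Below, $\mathbf E$, $\mathrm{var}$ and the expectations in the assumptions are taken over a fresh pair $(\mathsf x,\mathsf y)$ with $\mathsf x\sim\mathcal N(0,P)$, for fixed $g_{\mathcal T},a_{\mathcal T}$. For real $F,G$ put $$\Phi(F,G)=\sup_{\gamma\ge0}\Big\{\tfrac12\log(1+\gamma)-\tfrac{\gamma}{2}-\tfrac{\gamma^2}{1+\gamma}F+\gamma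 G\Big\}\in[0,+\infty],$$ and let $$I_{\mathrm{GMI},\mathcal T,A}=\Phi\Big(\frac{\mathbf E[g_{\mathcal T}(\mathsf y)^2]}{2a_{\mathcal T}^2P},\frac{\mathbf E[\mathsf x g_{\mathcal T}(\mathsf y)]}{a_{\mathcal T}P}\Big)$$ be the generalized mutual information (in nats) of the i.i.d. Gaussian codebook ensemble of power $P$ with nearest neighbor decoding based on $(g_{\mathcal T},a_{\mathcal T})$. With sums over the $n$ held-out samples, let $R_{\mathcal T}=\Phi(F_{\mathsf y},F_{\mathsf x\mathsf y})$, where $$F_{\mathsf y}=\frac1{2a_{\mathcal T}^2P}\Big[\frac1n\sum_i g_{\mathcal T}(\mathsf y_i)^2+\frac{\sqrt{2\,\overline{\mathrm{var}}(g_{\mathcal T}(\mathsf y)^2)}}{\sqrt n}\,\mathrm{erfc}^{-1}(P_{\mathrm{oe}})\Big],$$ $$F_{\mathsf x\mathsf y}=\frac1{a_{\mathcal T}P}\Big[\frac1n\sum_i \mathsf x_i g_{\mathcal T}(\mathsf y_i)-\mathrm{sgn}(a_{\mathcal T})\frac{\sqrt{2\,\overline{\mathrm{var}}(\mathsf x g_{\mathcal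 T}(\mathsf y))}}{\sqrt n}\,\mathrm{erfc}^{-1}(P_{\mathrm{oe}})\Big],$$ $\overline{\mathrm{var}}(U)=\frac1{n-1}\sum_i\big(U_i-\frac1n\sum_jU_j\big)^2$ is the empirical variance over the held-out samples, and $\mathrm{erfc}(x)=\frac{2}{\sqrt\pi}\int_x^\infty e^{-t^2}\,dt$. (If $a_{\mathcal T}=0$, the fractions are read as $0$, so that $R_{\mathcal T}=I_{\mathrm{GMI},\mathcal T,A}=0$.) Assume that the central limit theorem is applicable to the held-out samples, in the following sense: for every $L$, $\mathbf E[g_{\mathcal T}(\mathsf y)^4]<\infty$ almost surely; and for both $U=g_{\mathcal T}(\mathsf y)^2$ and $U=\mathsf x g_{\mathcal T}(\mathsf y)$ the Lindeberg condition holds in probability, i.e., for every $\varepsilon>0$, $$\frac{\mathbf E\big[(U-\mathbf E U)^2\,\mathbf 1\{|U-\mathbf E U|>\varepsilon\sqrt{n\,\mathrm{var}\,U}\}\big]}{\mathrm{var}\,U}\longrightarrow0\quad\text{in probability as }L\to\infty$$ (the ratio being read as $0$ if $\mathrm{var}\,U=0$). The Lindeberg condition holds automatically when $g_{\mathcal T}$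 is a fixed function with $\mathbf E[g_{\mathcal T}(\mathsf y)^4]<\infty$. Then $$\limsup_{L\to\infty}\Pr\big[R_{\mathcal T}>I_{\mathrm{GMI},\mathcal T,A}\big]\le P_{\mathrm{oe}}.$$ -/

import Mathlib

open MeasureTheory ProbabilityTheory Filter Topology
open scoped NNReal ENNReal

noncomputable section

/-- The complementary error function `erfc x = (2 / √π) ∫ₓ^∞ exp (-t²) dt`. -/
def erfc (x : ℝ) : ℝ := 2 / √Real.pi * ∫ t in Set.Ioi x, Real.exp (-t ^ 2)

/-- The inverse of `erfc`; `erfc` is a bijection from `ℝ` onto the interval `(0, 2)`, so this is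
the honest inverse there. -/
def erfcInv : ℝ → ℝ := Function.invFun erfc

/-- Empirical mean of `n` samples. -/
def sampleMean {n : ℕ} (u : Fin n → ℝ) : ℝ := (∑ i, u i) / n

/-- Empirical variance of `n` samples, with the normalization `1 / (n - 1)`. -/
def sampleVar {n : ℕ} (u : Fin n → ℝ) : ℝ := (∑ i, (u i - sampleMean u) ^ 2) / ((n : ℝ) - 1)

/-- The law of an input-output pair `(x, y)` with `x ∼ N(0, P)` and `y` drawn from the channel
`W(dy | x)`. -/
def pairLaw {Y : Type*} [MeasurableSpace Y] (P : ℝ≥0) (W : Kernel ℝ Y) : Measure (ℝ × Y) :=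
  gaussianReal 0 P ⊗ₘ W

/-- `sup_{γ ≥ 0} { ½ log (1 + γ) - γ/2 - γ²/(1 + γ) · Fy + γ · Fxy }`, as an extended real: the
supremum is `⊤` when the expression is unbounded. -/
def rateSup (Fy Fxy : ℝ) : EReal :=
  ⨆ γ : ℝ≥0, ((1 / 2 * Real.log (1 + γ) - γ / 2 - (γ : ℝ) ^ 2 / (1 + γ) * Fy + γ * Fxy : ℝ) : EReal)

/-- The GMI for the processing function `g` and the scaling parameter `a`, the expectations being
taken under `x ∼ N(0, P)`. For `a = 0` the fractions are `0` and the value is `0`, which is the GMI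
of a decoding metric that does not depend on the codeword. -/
def gmiA {Y : Type*} [MeasurableSpace Y] (P : ℝ≥0) (W : Kernel ℝ Y) (g : Y → ℝ) (a : ℝ) : EReal :=
  rateSup ((∫ z, g z.2 ^ 2 ∂pairLaw P W) / (2 * a ^ 2 * P))
    ((∫ z, z.1 * g z.2 ∂pairLaw P W) / (a * P))

/-- The biased estimate of `E[g(y)²] / (2 a² P)` from held-out samples `h`. -/
def estFy {Y : Type*} (P : ℝ≥0) (Poe : ℝ) (g : Y → ℝ) (a : ℝ) {n : ℕ} (h : Fin n → ℝ × Y) : ℝ :=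
  1 / (2 * a ^ 2 * P) *
    (sampleMean (fun i => g (h i).2 ^ 2) +
      √(2 * sampleVar (fun i => g (h i).2 ^ 2)) / √n * erfcInv Poe)

/-- The biased estimate of `E[x g(y)] / (a P)` from held-out samples `h`. -/
def estFxy {Y : Type*} (P : ℝ≥0) (Poe : ℝ) (g : Y → ℝ) (a : ℝ) {n : ℕ} (h : Fin n → ℝ × Y) : ℝ :=
  1 / (a * P) *
    (sampleMean (fun i => (h i).1 * g (h i).2) -
      Real.sign a * (√(2 * sampleVar (fun i => (h i).1 * g (h i).2)) / √n) * erfcInv Poe)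

/-- The code rate computed from the learnt pair `(g, a)` and the held-out samples `h`. -/
def estRate {Y : Type*} (P : ℝ≥0) (Poe : ℝ) (g : Y → ℝ) (a : ℝ) {n : ℕ} (h : Fin n → ℝ × Y) :
    EReal :=
  rateSup (estFy P Poe g a h) (estFxy P Poe g a h)

/-- Length of the held-out part of a data set of length `L`: `ν L`, rounded down. -/
def heldOutLen (ν : ℝ) (L : ℕ) : ℕ := ⌊ν * L⌋₊

/-- Length of the part of a data set of length `L` that is used for learning `g` and `a`. -/
def learnLen (ν : ℝ) (L : ℕ) : ℕ := L - heldOutLen ν L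

/-- The first `learnLen ν L` samples. -/
def learnPart {Y Ω : Type*} (ν : ℝ) (T : ℕ → Ω → ℝ × Y) (L : ℕ) (ω : Ω) :
    Fin (learnLen ν L) → ℝ × Y :=
  fun i => T i ω

/-- The remaining `heldOutLen ν L` samples among the first `L`. -/
def heldOutPart {Y Ω : Type*} (ν : ℝ) (T : ℕ → Ω → ℝ × Y) (L : ℕ) (ω : Ω) :
    Fin (heldOutLen ν L) → ℝ × Y :=
  fun i => T (learnLen ν L + i) ω

/-- A procedure which, for every data length `L`, learns a processing function and a scaling
parameter from the learning part of the data. -/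
structure Learner (Y : Type*) [MeasurableSpace Y] (ν : ℝ) where
  g : (L : ℕ) → (Fin (learnLen ν L) → ℝ × Y) → Y → ℝ
  a : (L : ℕ) → (Fin (learnLen ν L) → ℝ × Y) → ℝ
  measurable_g : ∀ L, Measurable (Function.uncurry (g L))
  measurable_a : ∀ L, Measurable (a L)

/-- The Lindeberg ratio `E[(U - m)² ; |U - m| > ε √n σ] / σ²` of a random variable `U` with mean `m`
and variance `σ²` under `ρ`, for samples of size `n`; it is `0` if `σ = 0`. -/
def lindebergRatio {S : Type*} [MeasurableSpace S] (ρ : Measure S) (U : S → ℝ) (n : ℕ) (ε : ℝ) :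
    ℝ :=
  (∫ s in {s | ε * √n * √(Var[U; ρ]) < |U s - ρ[U]|}, (U s - ρ[U]) ^ 2 ∂ρ) / Var[U; ρ]

end

/-! `rateSup` is antitone in its first argument and monotone in its second, so the estimated rate
can exceed the GMI only if a one-sided confidence bound fails: the upper one for E[g(y)²], or the
one for E[x g(y)] on the side fixed by the sign of `a`. Each failure has asymptotic probability at
most Poe/2, because a studentized mean is asymptotically standard normal and P(N(0,1) ≤ -√2 c) =
erfc(c)/2. The union bound gives Poe; the dependence between the two events is irrelevant.

The difficulty is that `g` is random and changes with L. Given the learning part, the held-out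
samples are still i.i.d. and `g` is fixed, so it suffices to have a bound uniform over all `g` with
small Lindeberg ratio (`exists_forall_pi_confidence_bound_le`). Uniformity comes from
compactness-style reasoning: a sequence of counterexamples would be a triangular array violating
Lindeberg's theorem (`exists_forall_pi_normalized_sum_le`). Studentization needs only that the
empirical variance is rarely too small, which follows from truncation and Chebyshev. Learning
outcomes with a large Lindeberg ratio have vanishing probability. -/

/-! ### Characteristic functions and the Lindeberg central limit theorem -/

theorem norm_pow_sub_pow_le_of_norm_le_one {a b : ℂ} (ha : ‖a‖ ≤ 1) (hb : ‖b‖ ≤ 1) (n : ℕ) :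
    ‖a ^ n - b ^ n‖ ≤ n * ‖a - b‖ := by
  induction n with
  | zero => simp
  | succ n ih =>
    have h : a ^ (n + 1) - b ^ (n + 1) = (a ^ n - b ^ n) * a + b ^ n * (a - b) := by ring
    rw [h]
    refine (norm_add_le _ _).trans ?_
    rw [norm_mul, norm_mul, norm_pow]
    have h1 : ‖a ^ n - b ^ n‖ * ‖a‖ ≤ n * ‖a - b‖ :=
      (mul_le_of_le_one_right (norm_nonneg _) ha).trans ih
    have h2 : ‖b‖ ^ n * ‖a - b‖ ≤ ‖a - b‖ :=
      mul_le_of_le_one_left (norm_nonneg _) (pow_le_one₀ (norm_nonneg _) hb)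
    push_cast
    linarith

theorem norm_exp_mul_I_sub_taylor_le_cube {x : ℝ} (hx : |x| ≤ 1) :
    ‖Complex.exp (x * Complex.I) - (1 + x * Complex.I - x ^ 2 / 2)‖ ≤ |x| ^ 3 := by
  have h := Complex.exp_bound (x := x * Complex.I) (by simpa using hx) (n := 3) (by norm_num)
  have e : ∑ m ∈ Finset.range 3, (x * Complex.I : ℂ) ^ m / (m.factorial : ℂ)
      = 1 + x * Complex.I - x ^ 2 / 2 := by
    simp only [Finset.sum_range_succ, Finset.sum_range_zero, Nat.factorial, mul_pow, Complex.I_sq]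
    push_cast
    ring
  rw [e] at h
  refine h.trans ?_
  have hn : ‖(x * Complex.I : ℂ)‖ = |x| := by simp
  rw [hn]
  refine mul_le_of_le_one_right (by positivity) ?_
  norm_num [Nat.factorial]

/-- Serves beyond the truncation level, where the argument need not be small: for |x| ≥ 1 the
triangle inequality gives 2 + |x| + x²/2, which is below 4x². -/
theorem norm_exp_mul_I_sub_taylor_le_sq (x : ℝ) :
    ‖Complex.exp (x * Complex.I) - (1 + x * Complex.I - x ^ 2 / 2)‖ ≤ 4 * x ^ 2 := by
  rcases le_total |x| 1 with hx | hx
  · refine (norm_exp_mul_I_sub_taylor_le_cube hx).trans ?_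
    rw [← sq_abs x]
    nlinarith [sq_nonneg |x|, abs_nonneg x]
  · have h1 : ‖Complex.exp (x * Complex.I) - (1 + x * Complex.I - x ^ 2 / 2)‖
        ≤ 1 + (1 + |x| + x ^ 2 / 2) := by
      refine (norm_sub_le _ _).trans (add_le_add (Complex.norm_exp_ofReal_mul_I x).le ?_)
      refine (norm_sub_le _ _).trans (add_le_add ((norm_add_le _ _).trans ?_) ?_)
      · simp
      · simp
    refine h1.trans ?_
    rw [← sq_abs x]
    nlinarith

/-- The second order Taylor remainder of the characteristic function of a standardized law,
controlled by a truncation level `B` and the truncated second moment. -/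
theorem norm_charFun_sub_taylor_le (κ : Measure ℝ) [IsProbabilityMeasure κ]
    (hint : Integrable (fun x : ℝ => x ^ 2) κ) (h0 : ∫ x, x ∂κ = 0) (h1 : ∫ x, x ^ 2 ∂κ = 1)
    {s B : ℝ} (hB : 0 ≤ B) (hsB : |s| * B ≤ 1) :
    ‖charFun κ s - (1 - s ^ 2 / 2)‖
      ≤ |s| ^ 3 * B + 4 * s ^ 2 * ∫ x in {x | B < |x|}, x ^ 2 ∂κ := by
  have hid : Integrable (fun x : ℝ => x) κ :=
    ((memLp_two_iff_integrable_sq (by fun_prop)).2 hint).integrable (by norm_num)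
  have hms : MeasurableSet {x : ℝ | B < |x|} := measurableSet_lt (by fun_prop) (by fun_prop)
  have e1 : charFun κ s - (1 - s ^ 2 / 2) = ∫ x, (Complex.exp ((s * x : ℝ) * Complex.I) -
      (1 + (s * x : ℝ) * Complex.I - ((s * x : ℝ) : ℂ) ^ 2 / 2)) ∂κ := by
    have i1 : Integrable (fun x : ℝ => Complex.exp ((s * x : ℝ) * Complex.I)) κ :=
      (integrable_const (1 : ℝ)).mono' (by fun_prop)
        (ae_of_all _ fun x => (Complex.norm_exp_ofReal_mul_I _).le)
    have i2 : Integrable (fun x : ℝ => ((s * x : ℝ) : ℂ) * Complex.I) κ :=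
      ((hid.const_mul s).ofReal).mul_const _
    have i3 : Integrable (fun x : ℝ => ((s * x : ℝ) : ℂ) ^ 2 / 2) κ := by
      have := ((hint.const_mul (s ^ 2)).ofReal (𝕜 := ℂ)).div_const 2
      refine this.congr (ae_of_all _ fun x => ?_)
      simp [mul_pow]
    have i4 : Integrable (fun x : ℝ => 1 + ((s * x : ℝ) : ℂ) * Complex.I) κ :=
      (integrable_const _).add i2
    have i5 : Integrable (fun x : ℝ => 1 + ((s * x : ℝ) : ℂ) * Complex.I -
        ((s * x : ℝ) : ℂ) ^ 2 / 2) κ := i4.sub i3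
    rw [integral_sub i1 i5, integral_sub i4 i3, integral_add (integrable_const _) i2]
    have j2 : ∫ x : ℝ, ((s * x : ℝ) : ℂ) * Complex.I ∂κ = 0 := by
      rw [integral_mul_const, integral_complex_ofReal, integral_const_mul, h0]
      simp
    have j3 : ∫ x : ℝ, ((s * x : ℝ) : ℂ) ^ 2 / 2 ∂κ = (s : ℂ) ^ 2 / 2 := by
      have : ∀ x : ℝ, ((s * x : ℝ) : ℂ) ^ 2 = ((s ^ 2 * x ^ 2 : ℝ) : ℂ) := by
        intro x; push_cast; ring
      simp_rw [this]
      rw [integral_div, integral_complex_ofReal, integral_const_mul, h1]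
      simp
    rw [j2, j3, charFun_apply_real]
    simp
  rw [e1]
  -- Up to `B` the cubic bound applies and one factor |x| is replaced by `B`; beyond it the
  -- quadratic bound feeds the truncated second moment.
  have hb : ∀ x : ℝ, ‖Complex.exp ((s * x : ℝ) * Complex.I) -
      (1 + (s * x : ℝ) * Complex.I - ((s * x : ℝ) : ℂ) ^ 2 / 2)‖
      ≤ |s| ^ 3 * B * x ^ 2 + {x : ℝ | B < |x|}.indicator (fun x => 4 * s ^ 2 * x ^ 2) x := by
    intro x
    by_cases hx : B < |x|
    · rw [Set.indicator_of_mem (by exact hx)]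
      have := norm_exp_mul_I_sub_taylor_le_sq (s * x)
      have h2 : 0 ≤ |s| ^ 3 * B * x ^ 2 := by positivity
      nlinarith
    · rw [Set.indicator_of_notMem (by exact hx), add_zero]
      push Not at hx
      have hsx : |s * x| ≤ 1 := by
        rw [abs_mul]
        exact (mul_le_mul_of_nonneg_left hx (abs_nonneg _)).trans hsB
      refine (norm_exp_mul_I_sub_taylor_le_cube hsx).trans ?_
      rw [abs_mul, mul_pow, ← sq_abs x, mul_assoc]
      refine mul_le_mul_of_nonneg_left ?_ (by positivity)
      nlinarith [sq_nonneg |x|]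
  refine (norm_integral_le_of_norm_le ?_ (ae_of_all _ hb)).trans ?_
  · exact (hint.const_mul _).add ((hint.const_mul _).indicator hms)
  · rw [integral_add (hint.const_mul _) ((hint.const_mul _).indicator hms), integral_const_mul, h1,
      integral_indicator hms, integral_const_mul, mul_one]

/-- The characteristic function of the normalized sum of `n` independent samples. -/
theorem charFun_pi_map_inv_sqrt_mul_sum (κ : Measure ℝ) [IsProbabilityMeasure κ] (n : ℕ) (t : ℝ) :
    charFun ((Measure.pi fun _ : Fin n => κ).map (fun p => (√n)⁻¹ * ∑ i, p i)) t
      = charFun κ ((√n)⁻¹ * t) ^ n := by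
  rw [charFun_map_mul_comp (by fun_prop), charFun_map_sum_pi_eq_prod]
  simp

/-- With s = t/√n, both φ(s) and exp(-s²/2) lie in the unit disc and are close to 1 - s²/2; passing
to n-th powers costs a factor n. Truncating at ε√n turns n|s|³ε√n into |t|³ε. -/
theorem norm_charFun_normalized_sum_sub_le (κ : Measure ℝ) [IsProbabilityMeasure κ]
    (hint : Integrable (fun x : ℝ => x ^ 2) κ) (h0 : ∫ x, x ∂κ = 0) (h1 : ∫ x, x ^ 2 ∂κ = 1)
    {n : ℕ} (hn : 0 < n) {t ε : ℝ} (hε : 0 ≤ ε) (htε : |t| * ε ≤ 1) (htn : t ^ 2 ≤ n) :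
    ‖charFun ((Measure.pi fun _ : Fin n => κ).map (fun p => (√n)⁻¹ * ∑ i, p i)) t
        - Complex.exp (-t ^ 2 / 2)‖
      ≤ |t| ^ 3 * ε + 4 * t ^ 2 * (∫ x in {x | ε * √n < |x|}, x ^ 2 ∂κ) + t ^ 4 / n := by
  have hn' : (0 : ℝ) < n := by exact_mod_cast hn
  have hs : 0 < √(n : ℝ) := Real.sqrt_pos.2 hn'
  have hss : √(n : ℝ) ^ 2 = n := Real.sq_sqrt hn'.le
  set r := √(n : ℝ) with hr
  set s := r⁻¹ * t with hsdef
  have hs2 : s ^ 2 = t ^ 2 / n := by rw [hsdef, mul_pow, inv_pow, hss]; field_simp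
  rw [charFun_pi_map_inv_sqrt_mul_sum]
  have e : Complex.exp (-t ^ 2 / 2) = Complex.exp ((-(s ^ 2 / 2) : ℝ)) ^ n := by
    have hnC : (n : ℂ) ≠ 0 := by exact_mod_cast hn.ne'
    rw [← Complex.exp_nat_mul, hs2]
    congr 1
    push_cast
    field_simp
  rw [e]
  have hsq : 0 ≤ s ^ 2 / 2 := by positivity
  have hsq1 : s ^ 2 / 2 ≤ 1 := by
    rw [hs2, div_div, div_le_one (by positivity)]
    linarith
  refine (norm_pow_sub_pow_le_of_norm_le_one (norm_charFun_le_one s) ?_ n).trans ?_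
  · rw [← Complex.ofReal_exp, Complex.norm_real, Real.norm_of_nonneg (Real.exp_nonneg _)]
    exact Real.exp_le_one_iff.2 (by linarith)
  have b1 := norm_charFun_sub_taylor_le κ hint h0 h1 (s := s) (B := ε * r) (by positivity) (by
    rw [hsdef, abs_mul, abs_of_pos (inv_pos.2 hs)]
    calc r⁻¹ * |t| * (ε * r) = |t| * ε := by field_simp
      _ ≤ 1 := htε)
  have b2 : ‖Complex.exp ((-(s ^ 2 / 2) : ℝ)) - (1 - s ^ 2 / 2)‖ ≤ (s ^ 2 / 2) ^ 2 := by
    have := Real.abs_exp_sub_one_sub_id_le (x := -(s ^ 2 / 2)) (by rwa [abs_neg, abs_of_nonneg hsq])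
    have e2 : Complex.exp ((-(s ^ 2 / 2) : ℝ)) - (1 - s ^ 2 / 2)
        = ((Real.exp (-(s ^ 2 / 2)) - 1 - -(s ^ 2 / 2) : ℝ) : ℂ) := by
      push_cast; ring
    rw [e2, Complex.norm_real, Real.norm_eq_abs]
    simpa using this
  have b3 : ‖charFun κ s - Complex.exp ((-(s ^ 2 / 2) : ℝ))‖
      ≤ |s| ^ 3 * (ε * r) + 4 * s ^ 2 * (∫ x in {x | ε * r < |x|}, x ^ 2 ∂κ)
        + (s ^ 2 / 2) ^ 2 := by
    have e3 : charFun κ s - Complex.exp ((-(s ^ 2 / 2) : ℝ)) = (charFun κ s - (1 - s ^ 2 / 2))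
      - (Complex.exp ((-(s ^ 2 / 2) : ℝ)) - (1 - s ^ 2 / 2)) := by ring
    rw [e3]
    exact (norm_sub_le _ _).trans (add_le_add b1 b2)
  refine (mul_le_mul_of_nonneg_left b3 hn'.le).trans ?_
  have c1 : (n : ℝ) * (|s| ^ 3 * (ε * r)) = |t| ^ 3 * ε := by
    rw [hsdef, abs_mul, abs_of_pos (inv_pos.2 hs), ← hss]
    field_simp
  have c2 : (n : ℝ) * s ^ 2 = t ^ 2 := by rw [hs2]; field_simp
  have c3 : (n : ℝ) * (s ^ 2 / 2) ^ 2 ≤ t ^ 4 / n := by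
    have : (n : ℝ) * (s ^ 2 / 2) ^ 2 = t ^ 4 / n / 4 := by
      rw [hs2]; field_simp; norm_num
    rw [this]
    have : 0 ≤ t ^ 4 / n := by positivity
    linarith
  set τ := ∫ x in {x | ε * r < |x|}, x ^ 2 ∂κ
  calc (n : ℝ) * (|s| ^ 3 * (ε * r) + 4 * s ^ 2 * τ + (s ^ 2 / 2) ^ 2)
      = (n : ℝ) * (|s| ^ 3 * (ε * r)) + 4 * (n * s ^ 2) * τ + n * (s ^ 2 / 2) ^ 2 := by ring
    _ ≤ _ := by rw [c1, c2]; linarith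

/-- **Lindeberg central limit theorem** for row-wise i.i.d. standardized arrays, with the Lindeberg
condition stated along a sequence of truncation levels tending to zero. -/
theorem tendsto_charFun_normalized_sum {κ : ℕ → Measure ℝ} [∀ k, IsProbabilityMeasure (κ k)]
    (hint : ∀ k, Integrable (fun x : ℝ => x ^ 2) (κ k)) (h0 : ∀ k, ∫ x, x ∂κ k = 0)
    (h1 : ∀ k, ∫ x, x ^ 2 ∂κ k = 1) {N : ℕ → ℕ} (hN : Tendsto N atTop atTop) {ε : ℕ → ℝ}
    (hε0 : ∀ k, 0 ≤ ε k) (hε : Tendsto ε atTop (𝓝 0))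
    (hlin : ∀ k, ∫ x in {x | ε k * √(N k) < |x|}, x ^ 2 ∂κ k ≤ ε k) (t : ℝ) :
    Tendsto (fun k => charFun
      ((Measure.pi fun _ : Fin (N k) => κ k).map (fun p => (√(N k))⁻¹ * ∑ i, p i)) t)
      atTop (𝓝 (Complex.exp (-t ^ 2 / 2))) := by
  rw [tendsto_iff_norm_sub_tendsto_zero]
  have hNr : Tendsto (fun k => (N k : ℝ)) atTop atTop := tendsto_natCast_atTop_atTop.comp hN
  have hlim : Tendsto (fun k => |t| ^ 3 * ε k + 4 * t ^ 2 * ε k + t ^ 4 / N k) atTop (𝓝 0) := by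
    simpa using ((hε.const_mul (|t| ^ 3)).add (hε.const_mul (4 * t ^ 2))).add
      (hNr.const_div_atTop (t ^ 4))
  have hte : ∀ᶠ k in atTop, |t| * ε k ≤ 1 := by
    have : Tendsto (fun k => |t| * ε k) atTop (𝓝 0) := by simpa using hε.const_mul |t|
    exact this.eventually_le_const one_pos
  refine squeeze_zero' (.of_forall fun _ => norm_nonneg _) ?_ hlim
  filter_upwards [hte, hN.eventually_gt_atTop 0, hNr.eventually_ge_atTop (t ^ 2)] with k k1 k2 k3
  refine (norm_charFun_normalized_sum_sub_le (κ k) (hint k) (h0 k) (h1 k) k2 (hε0 k) k1 k3).trans ?_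
  have := mul_le_mul_of_nonneg_left (hlin k) (by positivity : 0 ≤ 4 * t ^ 2)
  linarith

/-- The uniform form of the Lindeberg central limit theorem: a bound for the distribution function
of the normalized sum that depends only on the sample size and on the Lindeberg tail. -/
theorem exists_forall_pi_normalized_sum_le (x : ℝ) {δ : ℝ} (hδ : 0 < δ) :
    ∃ ε₀ > 0, ∃ n₀ : ℕ, ∀ n ≥ n₀, ∀ (κ : Measure ℝ) [IsProbabilityMeasure κ],
      Integrable (fun x : ℝ => x ^ 2) κ → ∫ x, x ∂κ = 0 → ∫ x, x ^ 2 ∂κ = 1 →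
      ∫ x in {x | ε₀ * √n < |x|}, x ^ 2 ∂κ ≤ ε₀ →
      (Measure.pi fun _ : Fin n => κ) {p | (√n)⁻¹ * ∑ i, p i ≤ x}
        ≤ gaussianReal 0 1 (Set.Iic x) + ENNReal.ofReal δ := by
  by_contra! hcon
  -- Failure at level 1/(k+1) and sample size at least k, for every k, yields an array satisfying
  -- the Lindeberg condition; portmanteau on the closed half-line then contradicts `hbad`.
  choose N hN κ hκ hint h0 h1 hlin hbad using fun k : ℕ => hcon (1 / ((k : ℝ) + 1)) (by positivity) k
  have hNt : Tendsto N atTop atTop := tendsto_atTop_mono hN tendsto_id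
  have hch := fun t => tendsto_charFun_normalized_sum hint h0 h1 hNt (ε := fun k => 1 / ((k : ℝ) + 1))
    (fun k => by positivity) tendsto_one_div_add_atTop_nhds_zero_nat hlin t
  have hm : ∀ k, Measurable (fun p : Fin (N k) → ℝ => (√(N k))⁻¹ * ∑ i, p i) := fun k => by fun_prop
  let Q : ℕ → ProbabilityMeasure ℝ := fun k =>
    ⟨(Measure.pi fun _ : Fin (N k) => κ k).map (fun p => (√(N k))⁻¹ * ∑ i, p i),
      Measure.isProbabilityMeasure_map (hm k).aemeasurable⟩
  have hQ : Tendsto Q atTop (𝓝 (⟨gaussianReal 0 1, inferInstance⟩ : ProbabilityMeasure ℝ)) := by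
    refine ProbabilityMeasure.tendsto_iff_tendsto_charFun.2 fun t => ?_
    have := hch t
    simpa [Q, charFun_gaussianReal, neg_div] using this
  have hport := ProbabilityMeasure.limsup_measure_closed_le_of_tendsto hQ (isClosed_Iic (a := x))
  have hQx : ∀ k, (Q k : Measure ℝ) (Set.Iic x)
      = (Measure.pi fun _ : Fin (N k) => κ k) {p | (√(N k))⁻¹ * ∑ i, p i ≤ x} := fun k => by
    change Measure.map _ _ _ = _
    rw [Measure.map_apply (hm k) measurableSet_Iic]
    rfl
  have hge : gaussianReal 0 1 (Set.Iic x) + ENNReal.ofReal δ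
      ≤ limsup (fun k => (Q k : Measure ℝ) (Set.Iic x)) atTop := by
    refine le_limsup_of_frequently_le (Frequently.of_forall fun k => ?_) (by isBoundedDefault)
    rw [hQx]
    exact (hbad k).le
  have := hge.trans hport
  simp only [ProbabilityMeasure.coe_mk] at this
  refine absurd this (not_le.2 (ENNReal.lt_add_right (measure_ne_top _ _) ?_))
  simpa using hδ

/-! ### Lower bounds for the empirical variance -/

/-- **Chebyshev's inequality** for a sum of independent samples. -/
theorem pi_abs_sum_sub_ge_le {S : Type*} [MeasurableSpace S] (κ : Measure S)
    [IsProbabilityMeasure κ] {f : S → ℝ} (hf : MemLp f 2 κ) (n : ℕ) {c : ℝ} (hc : 0 < c) :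
    (Measure.pi fun _ : Fin n => κ) {p | c ≤ |∑ i, f (p i) - n * ∫ x, f x ∂κ|}
      ≤ ENNReal.ofReal (n * Var[f; κ] / c ^ 2) := by
  have hmem : ∀ i : Fin n, MemLp (fun p : Fin n → S => f (p i)) 2 (Measure.pi fun _ => κ) :=
    fun i => hf.comp_measurePreserving (measurePreserving_eval (fun _ : Fin n => κ) i)
  have hX : MemLp (∑ i, fun p : Fin n → S => f (p i)) 2 (Measure.pi fun _ => κ) :=
    memLp_finsetSum' _ fun i _ => hmem i
  have h := meas_ge_le_variance_div_sq hX hc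
  rw [variance_sum_pi (fun _ => hf)] at h
  have hE : ∫ p, (∑ i, fun p : Fin n → S => f (p i)) p ∂(Measure.pi fun _ : Fin n => κ)
      = n * ∫ x, f x ∂κ := by
    simp only [Finset.sum_apply]
    rw [integral_finsetSum _ fun i _ => (hmem i).integrable (by norm_num)]
    have : ∀ i : Fin n, ∫ p : Fin n → S, f (p i) ∂(Measure.pi fun _ => κ) = ∫ x, f x ∂κ :=
      fun i => integral_comp_eval (μ := fun _ : Fin n => κ) hf.aestronglyMeasurable
    simp [this]
  rw [hE] at h
  simpa using h

theorem sum_sub_sampleMean_sq {n : ℕ} (p : Fin n → ℝ) :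
    ∑ i, (p i - sampleMean p) ^ 2 = ∑ i, p i ^ 2 - n * sampleMean p ^ 2 := by
  rcases Nat.eq_zero_or_pos n with rfl | hn
  · simp
  have hn' : (n : ℝ) ≠ 0 := by exact_mod_cast hn.ne'
  have hs : ∑ i, p i = n * sampleMean p := by rw [sampleMean]; field_simp
  have : ∀ i, (p i - sampleMean p) ^ 2
      = p i ^ 2 - 2 * sampleMean p * p i + sampleMean p ^ 2 := fun i => by ring
  simp_rw [this, Finset.sum_add_distrib, Finset.sum_sub_distrib, ← Finset.mul_sum, hs]
  simp
  ring

/-- The empirical second moment of standardized samples is unlikely to fall much below `1`. -/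
theorem pi_sum_sq_le_le (κ : Measure ℝ) [IsProbabilityMeasure κ]
    (hint : Integrable (fun x : ℝ => x ^ 2) κ) (h1 : ∫ x, x ^ 2 ∂κ = 1)
    {n : ℕ} (hn : 0 < n) {ε η : ℝ} (hη : 0 < η)
    (hlin : ∫ x in {x | ε * √n < |x|}, x ^ 2 ∂κ ≤ η) :
    (Measure.pi fun _ : Fin n => κ) {p | ∑ i, p i ^ 2 ≤ n * (1 - 2 * η)}
      ≤ ENNReal.ofReal (ε ^ 2 / η ^ 2) := by
  have hn' : (0 : ℝ) < n := by exact_mod_cast hn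
  set A : Set ℝ := {x | ε * √n < |x|} with hA
  have hms : MeasurableSet A := measurableSet_lt (by fun_prop) (by fun_prop)
  -- The law `κ` need not have a fourth moment, so squares are truncated: `q` has mean at least 1 -
  -- η, and q ≤ ε²n gives variance at most ε²n, hence n·ε²n/(nη)² = ε²/η² in Chebyshev.
  set q : ℝ → ℝ := Aᶜ.indicator (fun x => x ^ 2) with hq
  have hqm : Measurable q := (by fun_prop : Measurable fun x : ℝ => x ^ 2).indicator hms.compl
  have hq0 : ∀ x, 0 ≤ q x := fun x => Set.indicator_nonneg (fun _ _ => sq_nonneg _) x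
  have hqle : ∀ x, q x ≤ x ^ 2 := fun x => Set.indicator_le_self' (fun _ _ => sq_nonneg _) x
  have hqb : ∀ x, q x ≤ ε ^ 2 * n := fun x => by
    by_cases hx : x ∈ A
    · rw [hq, Set.indicator_of_notMem (by simpa using hx)]
      positivity
    · rw [hq, Set.indicator_of_mem (by exact hx)]
      have hx' : |x| ≤ ε * √n := not_lt.1 hx
      have := pow_le_pow_left₀ (abs_nonneg x) hx' 2
      rwa [sq_abs, mul_pow, Real.sq_sqrt hn'.le] at this
  have hqi : Integrable q κ := hint.indicator hms.compl
  have hqL : MemLp q 2 κ := by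
    refine MemLp.of_bound hqm.aestronglyMeasurable (ε ^ 2 * n) (ae_of_all _ fun x => ?_)
    rw [Real.norm_of_nonneg (hq0 x)]
    exact hqb x
  have hqE : 1 - η ≤ ∫ x, q x ∂κ := by
    have : ∫ x in A, x ^ 2 ∂κ + ∫ x in Aᶜ, x ^ 2 ∂κ = 1 := by
      rw [integral_add_compl hms hint, h1]
    rw [hq, integral_indicator hms.compl]
    linarith
  have hqV : Var[q; κ] ≤ ε ^ 2 * n := by
    refine (variance_le_expectation_sq hqm.aestronglyMeasurable).trans ?_
    calc ∫ x, (q ^ 2) x ∂κ ≤ ∫ x, ε ^ 2 * n * x ^ 2 ∂κ := by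
          refine integral_mono (hqL.integrable_sq) (hint.const_mul _) fun x => ?_
          change q x ^ 2 ≤ _
          rw [sq (q x)]
          exact mul_le_mul (hqb x) (hqle x) (hq0 x) (by positivity)
      _ = ε ^ 2 * n := by rw [integral_const_mul, h1, mul_one]
  have hc : (0 : ℝ) < n * η := by positivity
  refine (measure_mono fun p hp => ?_).trans ((pi_abs_sum_sub_ge_le κ hqL n hc).trans ?_)
  · have hp' : ∑ i, p i ^ 2 ≤ n * (1 - 2 * η) := hp
    have h2 : ∑ i, q (p i) ≤ ∑ i, p i ^ 2 := Finset.sum_le_sum fun i _ => hqle _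
    have h3 : (n : ℝ) * (1 - η) ≤ n * ∫ x, q x ∂κ := mul_le_mul_of_nonneg_left hqE hn'.le
    change (n : ℝ) * η ≤ |_|
    rw [abs_sub_comm]
    refine le_trans ?_ (le_abs_self _)
    linarith
  · refine ENNReal.ofReal_le_ofReal ?_
    rw [div_le_div_iff₀ (by positivity) (by positivity)]
    have := mul_le_mul_of_nonneg_left hqV (by positivity : (0 : ℝ) ≤ n * η ^ 2)
    nlinarith

/-- The empirical variance of standardized samples is unlikely to fall much below `1`. -/
theorem pi_sampleVar_lt_le (κ : Measure ℝ) [IsProbabilityMeasure κ]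
    (hint : Integrable (fun x : ℝ => x ^ 2) κ) (h0 : ∫ x, x ∂κ = 0) (h1 : ∫ x, x ^ 2 ∂κ = 1)
    {n : ℕ} (hn : 2 ≤ n) {ε η : ℝ} (hη : 0 < η) (hη' : η ≤ 1 / 3)
    (hlin : ∫ x in {x | ε * √n < |x|}, x ^ 2 ∂κ ≤ η) :
    (Measure.pi fun _ : Fin n => κ) {p | sampleVar p < 1 - 3 * η}
      ≤ ENNReal.ofReal (ε ^ 2 / η ^ 2) + ENNReal.ofReal (1 / (n * η)) := by
  have hn2 : (2 : ℝ) ≤ n := by exact_mod_cast hn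
  have hn' : (0 : ℝ) < n := by linarith
  have hid : MemLp (fun x : ℝ => x) 2 κ := (memLp_two_iff_integrable_sq (by fun_prop)).2 hint
  have hc : 0 < n * √η := by positivity
  have hch := pi_abs_sum_sub_ge_le κ hid n hc
  rw [h0, mul_zero] at hch
  have hv : Var[fun x : ℝ => x; κ] = 1 := by
    rw [variance_of_integral_eq_zero (by fun_prop) h0, h1]
  have he : (n : ℝ) * 1 / (n * √η) ^ 2 = 1 / (n * η) := by
    rw [mul_pow, Real.sq_sqrt hη.le]; field_simp
  rw [hv, he] at hch
  refine (measure_mono fun p hp => ?_).trans ((measure_union_le _ _).trans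
    (add_le_add (pi_sum_sq_le_le κ hint h1 (by omega) hη hlin) hch))
  by_contra hcon
  simp only [Set.mem_union, Set.mem_ofPred_eq, sub_zero, not_or, not_le] at hcon hp
  obtain ⟨a1, a2⟩ := hcon
  have a3 : sampleMean p ^ 2 < η := by
    have : |sampleMean p| < √η := by
      rw [sampleMean, abs_div, abs_of_pos hn', div_lt_iff₀ hn', mul_comm]
      exact a2
    have h4 := pow_lt_pow_left₀ this (abs_nonneg _) two_ne_zero
    rwa [sq_abs, Real.sq_sqrt hη.le] at h4
  rw [sampleVar, div_lt_iff₀ (by linarith), sum_sub_sampleMean_sq] at hp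
  -- The centred sum of squares exceeds n(1 - 2η) - nη = n(1 - 3η); since 1 - 3η ≥ 0, dividing by n
  -- - 1 instead of n only helps.
  have a4 := mul_lt_mul_of_pos_left a3 hn'
  nlinarith

/-! ### The studentized mean -/

theorem sampleMean_eq_inv_sqrt_mul {n : ℕ} (p : Fin n → ℝ) :
    sampleMean p = ((√n)⁻¹ * ∑ i, p i) / √n := by
  rw [sampleMean]
  conv_lhs => rw [← Real.mul_self_sqrt (Nat.cast_nonneg (α := ℝ) n)]
  rw [div_mul_eq_div_div, div_eq_inv_mul (∑ i, p i)]

/-- For standardized samples, the studentized mean falls below `-√2 * c` with at most Gaussian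
probability, up to an error that depends only on the sample size and on the Lindeberg tail. -/
theorem exists_forall_pi_studentized_le {c : ℝ} (hc : 0 ≤ c) {δ : ℝ} (hδ : 0 < δ) :
    ∃ ε₀ > 0, ∃ n₀ : ℕ, ∀ n ≥ n₀, ∀ (κ : Measure ℝ) [IsProbabilityMeasure κ],
      Integrable (fun x : ℝ => x ^ 2) κ → ∫ x, x ∂κ = 0 → ∫ x, x ^ 2 ∂κ = 1 →
      ∫ x in {x | ε₀ * √n < |x|}, x ^ 2 ∂κ ≤ ε₀ →
      (Measure.pi fun _ : Fin n => κ) {p | sampleMean p + √(2 * sampleVar p) / √n * c < 0}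
        ≤ gaussianReal 0 1 (Set.Iic (-(√2 * c))) + ENNReal.ofReal δ := by
  -- The loss in the variance moves the threshold to the right, so right continuity of the cdf
  -- allows a small enough `η`.
  obtain ⟨η, hη0, hη1, hη⟩ : ∃ η : ℝ, 0 < η ∧ η ≤ 1 / 3 ∧
      gaussianReal 0 1 (Set.Iic (-(√2 * c * √(1 - 3 * η))))
        ≤ gaussianReal 0 1 (Set.Iic (-(√2 * c))) + ENNReal.ofReal (δ / 4) := by
    have ht : Tendsto (fun η : ℝ => cdf (gaussianReal 0 1) (-(√2 * c * √(1 - 3 * η)))) (𝓝[>] 0)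
        (𝓝 (cdf (gaussianReal 0 1) (-(√2 * c)))) := by
      refine ((cdf (gaussianReal 0 1)).right_continuous (-(√2 * c))).tendsto.comp
        (tendsto_nhdsWithin_iff.2 ⟨?_, ?_⟩)
      · have h : Continuous fun η : ℝ => -(√2 * c * √(1 - 3 * η)) := by fun_prop
        have := (h.tendsto 0).mono_left (nhdsWithin_le_nhds (s := Set.Ioi 0))
        simpa using this
      · filter_upwards [self_mem_nhdsWithin] with η hη
        have hη0 : 0 < η := hη
        refine neg_le_neg (mul_le_of_le_one_right (by positivity) (Real.sqrt_le_one.2 ?_))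
        linarith
    have e1 := ht.eventually_le_const (by linarith :
      cdf (gaussianReal 0 1) (-(√2 * c)) < cdf (gaussianReal 0 1) (-(√2 * c)) + δ / 4)
    have e2 : ∀ᶠ η : ℝ in 𝓝[>] 0, η ≤ 1 / 3 :=
      nhdsWithin_le_nhds (eventually_le_nhds (by norm_num))
    obtain ⟨η, g1, g2, g3⟩ := (e1.and (e2.and self_mem_nhdsWithin)).exists
    refine ⟨η, g3, g2, ?_⟩
    rw [← ofReal_cdf, ← ofReal_cdf, ← ENNReal.ofReal_add (cdf_nonneg _ _) (by positivity)]
    exact ENNReal.ofReal_le_ofReal g1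
  obtain ⟨ε₁, hε₁, n₁, H⟩ := exists_forall_pi_normalized_sum_le (-(√2 * c * √(1 - 3 * η)))
    (by positivity : 0 < δ / 4)
  obtain ⟨n₂, hn₂⟩ := exists_nat_gt (4 / (η * δ))
  have hε₂ : 0 < η * √(δ / 4) := by positivity
  -- The three levels serve the limit theorem, the variance bound, and ε²/η² ≤ δ/4; `n₂` ensures
  -- 1/(nη) ≤ δ/4, and 2 keeps n - 1 positive.
  refine ⟨min ε₁ (min η (η * √(δ / 4))), by positivity, max (max n₁ n₂) 2, ?_⟩
  intro n hn κ _ hint h0 h1 hlin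
  set ε := min ε₁ (min η (η * √(δ / 4))) with hε
  have hε0 : 0 < ε := by positivity
  have hn1 : n₁ ≤ n := (le_max_left _ _).trans ((le_max_left _ _).trans hn)
  have hn2 : n₂ ≤ n := (le_max_right _ _).trans ((le_max_left _ _).trans hn)
  have hn3 : 2 ≤ n := (le_max_right _ _).trans hn
  have hnpos : (0 : ℝ) < n := by exact_mod_cast (by omega : 0 < n)
  have hs : 0 < √(n : ℝ) := Real.sqrt_pos.2 hnpos
  have hεε₁ : ε ≤ ε₁ := min_le_left _ _
  have hlin₁ : ∫ x in {x | ε₁ * √n < |x|}, x ^ 2 ∂κ ≤ ε₁ := by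
    refine (setIntegral_mono_set hint.integrableOn (ae_of_all _ fun _ => sq_nonneg _)
      (LE.le.eventuallyLE fun x hx => ?_)).trans (hlin.trans hεε₁)
    exact lt_of_le_of_lt (mul_le_mul_of_nonneg_right hεε₁ hs.le) hx
  have b1 := H n hn1 κ hint h0 h1 hlin₁
  have b2 := pi_sampleVar_lt_le κ hint h0 h1 hn3 hη0 hη1
    (hlin.trans ((min_le_right _ _).trans (min_le_left _ _)))
  have b3 : ENNReal.ofReal (ε ^ 2 / η ^ 2) ≤ ENNReal.ofReal (δ / 4) := by
    refine ENNReal.ofReal_le_ofReal ?_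
    rw [div_le_iff₀ (by positivity)]
    have h := pow_le_pow_left₀ hε0.le
      ((min_le_right _ _).trans (min_le_right _ _) : ε ≤ η * √(δ / 4)) 2
    rw [mul_pow, Real.sq_sqrt (by positivity)] at h
    linarith
  have b4 : ENNReal.ofReal (1 / (n * η)) ≤ ENNReal.ofReal (δ / 4) := by
    refine ENNReal.ofReal_le_ofReal ?_
    have : 4 / (η * δ) < n := hn₂.trans_le (by exact_mod_cast hn2)
    rw [div_lt_iff₀ (by positivity)] at this
    rw [div_le_iff₀ (by positivity)]
    linarith
  have hsub : {p : Fin n → ℝ | sampleMean p + √(2 * sampleVar p) / √n * c < 0} ⊆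
      {p | (√n)⁻¹ * ∑ i, p i ≤ -(√2 * c * √(1 - 3 * η))} ∪ {p | sampleVar p < 1 - 3 * η} := by
    intro p hp
    by_contra hcon
    simp only [Set.mem_union, Set.mem_ofPred_eq, not_or, not_le, not_lt] at hcon hp
    obtain ⟨a1, a2⟩ := hcon
    have a3 : √(1 - 3 * η) ≤ √(sampleVar p) := Real.sqrt_le_sqrt a2
    have a4 : √2 * c * √(1 - 3 * η) ≤ √2 * c * √(sampleVar p) :=
      mul_le_mul_of_nonneg_left a3 (by positivity)
    rw [sampleMean_eq_inv_sqrt_mul, Real.sqrt_mul (by norm_num), div_mul_eq_mul_div, ← add_div,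
      div_lt_iff₀ hs, zero_mul] at hp
    nlinarith
  calc (Measure.pi fun _ : Fin n => κ) {p | sampleMean p + √(2 * sampleVar p) / √n * c < 0}
      ≤ (gaussianReal 0 1 (Set.Iic (-(√2 * c))) + ENNReal.ofReal (δ / 4) + ENNReal.ofReal (δ / 4))
        + (ENNReal.ofReal (δ / 4) + ENNReal.ofReal (δ / 4)) := by
        refine (measure_mono hsub).trans ((measure_union_le _ _).trans (add_le_add (b1.trans ?_)
          (b2.trans (add_le_add b3 b4))))
        gcongr
    _ = gaussianReal 0 1 (Set.Iic (-(√2 * c))) + ENNReal.ofReal δ := by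
        rw [add_assoc, add_assoc, ← ENNReal.ofReal_add (by positivity) (by positivity),
          ← ENNReal.ofReal_add (by positivity) (by positivity),
          ← ENNReal.ofReal_add (by positivity) (by positivity)]
        ring_nf

/-! ### The complementary error function and its inverse -/

/-- The substitution x = √2 t, which explains the factor √2 in the bias terms. -/
theorem gaussianReal_Iic_neg_sqrt_two_mul (c : ℝ) :
    gaussianReal 0 1 (Set.Iic (-(√2 * c))) = ENNReal.ofReal (erfc c / 2) := by
  have h2 : (0 : ℝ) < √2 := by positivity
  rw [gaussianReal_apply_eq_integral _ one_ne_zero, ← integral_comp_neg_Ioi]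
  congr 1
  have h := integral_comp_mul_left_Ioi (fun x => gaussianPDFReal 0 1 (-x)) c h2
  rw [smul_eq_mul, eq_comm, inv_mul_eq_iff_eq_mul₀ h2.ne'] at h
  rw [h, erfc]
  have e : ∀ x : ℝ, gaussianPDFReal 0 1 (-(√2 * x)) = (√(2 * Real.pi))⁻¹ * Real.exp (-x ^ 2) := by
    intro x
    rw [gaussianPDFReal]
    simp only [NNReal.coe_one, mul_one, sub_zero, neg_sq, mul_pow]
    rw [Real.sq_sqrt (by norm_num)]
    congr 2
    ring
  simp_rw [e]
  rw [integral_const_mul, Real.sqrt_mul (by norm_num)]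
  have : 0 < √Real.pi := Real.sqrt_pos.2 Real.pi_pos
  field_simp

theorem erfc_eq_one_sub (x : ℝ) :
    erfc x = 1 - 2 / √Real.pi * ∫ t in (0 : ℝ)..x, Real.exp (-t ^ 2) := by
  have hi : Integrable fun t : ℝ => Real.exp (-t ^ 2) := by
    simpa using integrable_exp_neg_mul_sq one_pos
  have h0 : ∫ t in Set.Ioi (0 : ℝ), Real.exp (-t ^ 2) = √Real.pi / 2 := by
    simpa using integral_gaussian_Ioi 1
  have h := intervalIntegral.integral_interval_add_Ioi (a := 0) (b := x)
    hi.integrableOn hi.integrableOn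
  have : 0 < √Real.pi := Real.sqrt_pos.2 Real.pi_pos
  rw [h0] at h
  rw [erfc, eq_sub_iff_add_eq'.2 h]
  field_simp

theorem continuous_erfc : Continuous erfc := by
  have : erfc = fun x => 1 - 2 / √Real.pi * ∫ t in (0 : ℝ)..x, Real.exp (-t ^ 2) :=
    funext erfc_eq_one_sub
  rw [this]
  refine continuous_const.sub (continuous_const.mul ?_)
  exact intervalIntegral.continuous_primitive
    (fun a b => (by fun_prop : Continuous fun t : ℝ => Real.exp (-t ^ 2)).intervalIntegrable a b) 0

theorem erfc_nonneg (x : ℝ) : 0 ≤ erfc x :=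
  mul_nonneg (by positivity) (integral_nonneg fun _ => (Real.exp_nonneg _))

theorem erfc_zero : erfc 0 = 1 := by rw [erfc_eq_one_sub]; simp

theorem one_lt_erfc_of_neg {x : ℝ} (hx : x < 0) : 1 < erfc x := by
  rw [erfc_eq_one_sub, intervalIntegral.integral_symm]
  have h : 0 < ∫ t in x..(0 : ℝ), Real.exp (-t ^ 2) :=
    intervalIntegral.intervalIntegral_pos_of_pos
      ((by fun_prop : Continuous fun t : ℝ => Real.exp (-t ^ 2)).intervalIntegrable _ _)
      (fun _ => Real.exp_pos _) hx
  have h2 : 0 < 2 / √Real.pi := div_pos two_pos (Real.sqrt_pos.2 Real.pi_pos)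
  nlinarith [mul_pos h2 h]

theorem tendsto_erfc_atTop : Tendsto erfc atTop (𝓝 0) := by
  have h : erfc = fun c => 2 * cdf (gaussianReal 0 1) (-(√2 * c)) := by
    funext c
    have := gaussianReal_Iic_neg_sqrt_two_mul c
    rw [← ofReal_cdf, ENNReal.ofReal_eq_ofReal_iff (cdf_nonneg _ _)
      (by have := erfc_nonneg c; positivity)] at this
    rw [this]
    ring
  rw [h]
  have ht : Tendsto (fun c : ℝ => -(√2 * c)) atTop atBot :=
    tendsto_neg_atTop_atBot.comp (tendsto_id.const_mul_atTop (by positivity))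
  simpa using ((tendsto_cdf_atBot (gaussianReal 0 1)).comp ht).const_mul 2

theorem erfc_erfcInv {p : ℝ} (hp0 : 0 < p) (hp1 : p ≤ 1) : erfc (erfcInv p) = p := by
  have hex : p ∈ Set.range erfc := by
    refine mem_range_of_exists_le_of_exists_ge continuous_erfc ?_ ⟨0, by rwa [erfc_zero]⟩
    exact (tendsto_erfc_atTop.eventually_le_const hp0).exists
  exact Function.invFun_eq hex

/-- Here Poe ≤ 1 matters. With a nonnegative multiplier, a lower bound on the empirical variance is
all that studentization requires. -/
theorem erfcInv_nonneg {p : ℝ} (hp0 : 0 < p) (hp1 : p ≤ 1) : 0 ≤ erfcInv p := by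
  by_contra! h
  have := one_lt_erfc_of_neg h
  rw [erfc_erfcInv hp0 hp1] at this
  linarith

/-! ### Standardization and the confidence bound for one mean -/

theorem sampleMean_sub_div {n : ℕ} (hn : 0 < n) (u : Fin n → ℝ) (m s : ℝ) :
    sampleMean (fun i => (u i - m) / s) = (sampleMean u - m) / s := by
  have hn' : (n : ℝ) ≠ 0 := by exact_mod_cast hn.ne'
  simp only [sampleMean, ← Finset.sum_div, Finset.sum_sub_distrib, Finset.sum_const,
    Finset.card_univ, Fintype.card_fin, nsmul_eq_mul]
  rw [div_right_comm, sub_div, mul_div_cancel_left₀ _ hn']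

theorem sampleVar_sub_div {n : ℕ} (hn : 0 < n) (u : Fin n → ℝ) (m s : ℝ) :
    sampleVar (fun i => (u i - m) / s) = sampleVar u / s ^ 2 := by
  have h : ∑ i, ((u i - m) / s - (sampleMean u - m) / s) ^ 2
      = (∑ i, (u i - sampleMean u) ^ 2) / s ^ 2 := by
    rw [Finset.sum_div]
    refine Finset.sum_congr rfl fun i _ => ?_
    rw [← sub_div, div_pow, sub_sub_sub_cancel_right]
  rw [sampleVar, sampleVar, sampleMean_sub_div hn, h, div_right_comm]

theorem lindebergRatio_eq_map {S : Type*} [MeasurableSpace S] (ρ : Measure S) {U : S → ℝ}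
    (hU : Measurable U) (hv : 0 < Var[U; ρ]) (n : ℕ) (ε : ℝ) :
    lindebergRatio ρ U n ε = ∫ x in {x | ε * √n < |x|}, x ^ 2
      ∂(ρ.map fun s => (U s - ρ[U]) / √(Var[U; ρ])) := by
  have hs : 0 < √(Var[U; ρ]) := Real.sqrt_pos.2 hv
  have hms : MeasurableSet {x : ℝ | ε * √n < |x|} := measurableSet_lt (by fun_prop) (by fun_prop)
  have hV : Measurable fun s => (U s - ρ[U]) / √(Var[U; ρ]) := by fun_prop
  rw [setIntegral_map hms (by fun_prop) hV.aemeasurable, lindebergRatio, ← integral_div]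
  have hset : {s | ε * √n * √(Var[U; ρ]) < |U s - ρ[U]|}
      = (fun s => (U s - ρ[U]) / √(Var[U; ρ])) ⁻¹' {x : ℝ | ε * √n < |x|} := by
    ext s
    simp only [Set.mem_ofPred_eq, Set.mem_preimage]
    rw [abs_div, abs_of_pos hs, lt_div_iff₀ hs]
  rw [hset]
  refine integral_congr_ae (ae_of_all _ fun s => ?_)
  simp only [div_pow, Real.sq_sqrt hv.le]

/-- A one-sided confidence bound for the mean of `U` from `n` independent samples, with an error
that depends only on the sample size and on the Lindeberg ratio. -/
theorem exists_forall_pi_confidence_bound_le {Poe : ℝ} (hPoe0 : 0 < Poe) (hPoe1 : Poe ≤ 1) {δ : ℝ}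
    (hδ : 0 < δ) {S : Type*} [MeasurableSpace S] (ρ : Measure S) [IsProbabilityMeasure ρ] :
    ∃ ε₀ > 0, ∃ n₀ : ℕ, ∀ n ≥ n₀, ∀ U : S → ℝ, Measurable U → MemLp U 2 ρ →
      lindebergRatio ρ U n ε₀ ≤ ε₀ →
      (Measure.pi fun _ : Fin n => ρ) {h | sampleMean (fun i => U (h i)) +
          √(2 * sampleVar (fun i => U (h i))) / √n * erfcInv Poe < ρ[U]}
        ≤ ENNReal.ofReal (Poe / 2) + ENNReal.ofReal δ := by
  have hc := erfcInv_nonneg hPoe0 hPoe1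
  obtain ⟨ε₀, hε₀, n₀, H⟩ := exists_forall_pi_studentized_le hc hδ
  refine ⟨ε₀, hε₀, max n₀ 1, fun n hn U hU hU2 hlin => ?_⟩
  have hn0 : n₀ ≤ n := (le_max_left _ _).trans hn
  have hn1 : 0 < n := (le_max_right _ _).trans hn
  have hn1' : (n : ℝ) ≠ 0 := by exact_mod_cast hn1.ne'
  rcases (variance_nonneg U ρ).eq_or_lt with hv | hv
  -- Standardization is impossible at zero variance, but then every sample almost surely equals the
  -- mean and the nonnegative bias excludes failure.
  · have hae : ∀ᵐ s ∂ρ, U s = ρ[U] := ae_eq_integral_of_variance_eq_zero hU2 hv.symm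
    have hall : ∀ᵐ h ∂(Measure.pi fun _ : Fin n => ρ), ∀ i, U (h i) = ρ[U] :=
      ae_all_iff.2 fun i =>
        (measurePreserving_eval (fun _ : Fin n => ρ) i).quasiMeasurePreserving.ae hae
    refine le_of_eq_of_le ?_ zero_le
    refine measure_mono_null ?_ (ae_iff.1 hall)
    intro h hh hcon
    simp only [Set.mem_ofPred_eq, hcon] at hh
    have : sampleMean (fun _ : Fin n => ρ[U]) = ρ[U] := by
      simp [sampleMean, hn1']
    rw [this] at hh
    have : 0 ≤ √(2 * sampleVar (fun _ : Fin n => ρ[U])) / √n * erfcInv Poe := by positivity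
    linarith
  · set m := ρ[U] with hm
    set v := Var[U; ρ] with hvdef
    have hs : 0 < √v := Real.sqrt_pos.2 hv
    have hV : Measurable fun s => (U s - m) / √v := by fun_prop
    set κ := ρ.map fun s => (U s - m) / √v with hκ
    have hκp : IsProbabilityMeasure κ := Measure.isProbabilityMeasure_map hV.aemeasurable
    have hUi : Integrable U ρ := hU2.integrable (by norm_num)
    have hsq : Integrable (fun s => (U s - m) ^ 2) ρ := (hU2.sub (memLp_const m)).integrable_sq
    have hint : Integrable (fun x : ℝ => x ^ 2) κ := by
      rw [hκ, integrable_map_measure (by fun_prop) hV.aemeasurable]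
      refine (hsq.div_const (√v ^ 2)).congr (ae_of_all _ fun s => ?_)
      simp [div_pow]
    have h0 : ∫ x, x ∂κ = 0 := by
      rw [hκ, integral_map hV.aemeasurable (by fun_prop), integral_div,
        integral_sub hUi (integrable_const _)]
      simp [hm]
    have h1 : ∫ x, x ^ 2 ∂κ = 1 := by
      rw [hκ, integral_map hV.aemeasurable (by fun_prop)]
      simp only [div_pow]
      rw [integral_div, ← variance_eq_integral hU.aemeasurable, Real.sq_sqrt hv.le, div_self hv.ne']
    rw [lindebergRatio_eq_map ρ hU hv] at hlin
    have hb := H n hn0 κ hint h0 h1 hlin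
    rw [gaussianReal_Iic_neg_sqrt_two_mul, erfc_erfcInv hPoe0 hPoe1] at hb
    refine le_trans ?_ hb
    have hpi : Measure.pi (fun _ : Fin n => κ)
        = (Measure.pi fun _ : Fin n => ρ).map (fun h i => (U (h i) - m) / √v) :=
      (Measure.pi_map_pi (fun _ => hV.aemeasurable)).symm
    rw [hpi]
    -- Mean and standard deviation scale alike, so failure for `U` is failure for the standardized
    -- samples; `Measure.le_map_apply` asks for no measurability of the event.
    refine le_trans (measure_mono fun h hh => ?_)
      (Measure.le_map_apply (Measurable.aemeasurable (by fun_prop)) _)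
    simp only [Set.mem_preimage, Set.mem_ofPred_eq] at hh ⊢
    rw [sampleMean_sub_div hn1, sampleVar_sub_div hn1, ← mul_div_assoc,
      Real.sqrt_div' _ (by positivity), Real.sqrt_sq hs.le, div_right_comm, div_mul_eq_mul_div,
      ← add_div]
    exact div_neg_of_neg_of_pos (by linarith) hs

/-! ### From rates to confidence bounds -/

theorem rateSup_mono {Fy Fy' Fxy Fxy' : ℝ} (hy : Fy' ≤ Fy) (hxy : Fxy ≤ Fxy') :
    rateSup Fy Fxy ≤ rateSup Fy' Fxy' := by
  refine iSup_mono fun γ => EReal.coe_le_coe_iff.2 ?_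
  have h1 : (γ : ℝ) ^ 2 / (1 + γ) * Fy' ≤ (γ : ℝ) ^ 2 / (1 + γ) * Fy :=
    mul_le_mul_of_nonneg_left hy (by positivity)
  have h2 : (γ : ℝ) * Fxy ≤ γ * Fxy' := mul_le_mul_of_nonneg_left hxy γ.2
  linarith

theorem sampleMean_neg {n : ℕ} (u : Fin n → ℝ) : sampleMean (fun i => -u i) = -sampleMean u := by
  simp [sampleMean, neg_div]

theorem sampleVar_neg {n : ℕ} (u : Fin n → ℝ) : sampleVar (fun i => -u i) = sampleVar u := by
  rw [sampleVar, sampleVar, sampleMean_neg]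
  congr 1
  exact Finset.sum_congr rfl fun i _ => by ring

theorem lindebergRatio_neg {S : Type*} [MeasurableSpace S] (ρ : Measure S) (U : S → ℝ) (n : ℕ)
    (ε : ℝ) : lindebergRatio ρ (fun s => -U s) n ε = lindebergRatio ρ U n ε := by
  have hv : Var[fun s => -U s; ρ] = Var[U; ρ] := variance_fun_neg
  have h1 : ∀ s, |-U s - -ρ[U]| = |U s - ρ[U]| := fun s => by rw [← abs_neg]; congr 1; ring
  have h2 : ∀ s, (-U s - -ρ[U]) ^ 2 = (U s - ρ[U]) ^ 2 := fun s => by ring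
  simp only [lindebergRatio, hv, integral_neg, h1, h2]

/-- The event that the upper confidence bound for the mean of `U`, computed from `n` samples, falls
short of that mean. -/
def confidenceFailure {S : Type*} [MeasurableSpace S] (ρ : Measure S) (c : ℝ) (U : S → ℝ) (n : ℕ) :
    Set (Fin n → S) :=
  {h | sampleMean (fun i => U (h i)) + √(2 * sampleVar (fun i => U (h i))) / √n * c < ρ[U]}

/-- If the estimated rate exceeds the GMI, then one of the one-sided confidence bounds fails. -/
theorem confidenceFailure_of_gmiA_lt_estRate {Y : Type*} [MeasurableSpace Y] {P : ℝ≥0} (hP : 0 < P)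
    (W : Kernel ℝ Y) (Poe : ℝ) (g : Y → ℝ) (a : ℝ) {n : ℕ} (h : Fin n → ℝ × Y)
    (hlt : gmiA P W g a < estRate P Poe g a h) :
    h ∈ confidenceFailure (pairLaw P W) (erfcInv Poe) (fun z => g z.2 ^ 2) n ∨
    (a < 0 ∧ h ∈ confidenceFailure (pairLaw P W) (erfcInv Poe) (fun z => z.1 * g z.2) n) ∨
    (0 < a ∧ h ∈ confidenceFailure (pairLaw P W) (erfcInv Poe) (fun z => -(z.1 * g z.2)) n) := by
  have hP' : (0 : ℝ) < P := hP
  by_contra! hcon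
  obtain ⟨c1, c2, c3⟩ := hcon
  refine absurd hlt (not_lt.2 (rateSup_mono ?_ ?_))
  · simp only [confidenceFailure, Set.mem_ofPred_eq, not_lt] at c1
    rw [estFy, one_div, div_eq_inv_mul]
    exact mul_le_mul_of_nonneg_left c1 (by positivity)
  · rw [estFxy, one_div, div_eq_inv_mul (∫ z, z.1 * g z.2 ∂pairLaw P W)]
    rcases lt_trichotomy a 0 with ha | rfl | ha
    · have c2' := c2 ha
      simp only [confidenceFailure, Set.mem_ofPred_eq, not_lt] at c2'
      rw [Real.sign_of_neg ha]
      refine mul_le_mul_of_nonpos_left ?_ (inv_nonpos.2 (mul_nonpos_of_nonpos_of_nonneg ha.le hP'.le))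
      linarith
    -- At a = 0 division by zero makes both second arguments 0.
    · simp
    · have c3' := c3 ha
      simp only [confidenceFailure, Set.mem_ofPred_eq, not_lt] at c3'
      rw [sampleMean_neg, sampleVar_neg, integral_neg] at c3'
      rw [Real.sign_of_pos ha]
      refine mul_le_mul_of_nonneg_left ?_ (by positivity)
      linarith

/-! ### Measurability and the data split -/

theorem measurable_sampleMean {n : ℕ} : Measurable (sampleMean (n := n)) := by
  unfold sampleMean; fun_prop

theorem measurable_sampleVar {n : ℕ} : Measurable (sampleVar (n := n)) := by
  have := measurable_sampleMean (n := n)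
  unfold sampleVar; fun_prop

/-- Joint measurability in the learning data and the held-out sample is what Fubini needs when
conditioning on the former. -/
theorem measurableSet_confidenceFailure {D S : Type*} [MeasurableSpace D] [MeasurableSpace S]
    (ρ : Measure S) [SFinite ρ] (c : ℝ) (n : ℕ) {U : D → S → ℝ}
    (hU : Measurable (Function.uncurry U)) :
    MeasurableSet {q : D × (Fin n → S) | q.2 ∈ confidenceFailure ρ c (U q.1) n} := by
  have h1 : Measurable fun q : D × (Fin n → S) => fun i => U q.1 (q.2 i) :=
    measurable_pi_lambda _ fun i =>
      hU.comp (measurable_fst.prodMk ((measurable_pi_apply i).comp measurable_snd))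
  have h2 : Measurable fun t => ∫ s, U t s ∂ρ :=
    (hU.stronglyMeasurable.integral_prod_right').measurable
  have h3 := measurable_sampleMean.comp h1
  have h4 := measurable_sampleVar.comp h1
  refine measurableSet_lt ?_ (h2.comp measurable_fst)
  exact h3.add (((h4.const_mul 2).sqrt.div_const _).mul_const _)

/-- The learning part and the held-out part of i.i.d. data are independent i.i.d. samples. -/
theorem map_learnPart_heldOutPart {Ω Y : Type*} [MeasurableSpace Ω] [MeasurableSpace Y]
    {μ : Measure Ω} [IsProbabilityMeasure μ] {ρ : Measure (ℝ × Y)} [IsProbabilityMeasure ρ]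
    {T : ℕ → Ω → ℝ × Y} (hT : ∀ i, HasLaw (T i) ρ μ) (hindep : iIndepFun T μ) (ν : ℝ) (L : ℕ) :
    μ.map (fun ω => (learnPart ν T L ω, heldOutPart ν T L ω)) =
      (Measure.pi fun _ : Fin (learnLen ν L) => ρ).prod
        (Measure.pi fun _ : Fin (heldOutLen ν L) => ρ) := by
  let e : Fin (learnLen ν L) ⊕ Fin (heldOutLen ν L) → ℕ :=
    Sum.elim (fun i => i) (fun i => learnLen ν L + i)
  have he : Function.Injective e := by
    rintro (i | i) (j | j) h <;> simp only [e, Sum.elim_inl, Sum.elim_inr] at h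
    · rw [Fin.ext h]
    · omega
    · omega
    · rw [Fin.ext (Nat.add_left_cancel h)]
  have hmap := (iIndepFun_iff_map_fun_eq_pi_map (fun i => (hT (e i)).aemeasurable)).1
    (hindep.precomp he)
  simp_rw [fun i => (hT (e i)).map_eq] at hmap
  have hpres := measurePreserving_sumPiEquivProdPi
    (fun _ : Fin (learnLen ν L) ⊕ Fin (heldOutLen ν L) => ρ)
  rw [← hpres.map_eq, ← hmap, AEMeasurable.map_map_of_aemeasurable]
  · rfl
  · exact hpres.measurable.aemeasurable
  · exact aemeasurable_pi_lambda _ fun i => (hT (e i)).aemeasurable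

instance isProbabilityMeasure_pairLaw {Y : Type*} [MeasurableSpace Y] (P : ℝ≥0) (W : Kernel ℝ Y)
    [IsMarkovKernel W] : IsProbabilityMeasure (pairLaw P W) := by
  unfold pairLaw; infer_instance

theorem memLp_fst_pairLaw {Y : Type*} [MeasurableSpace Y] (P : ℝ≥0) (W : Kernel ℝ Y)
    [IsMarkovKernel W] (p : ℝ≥0) : MemLp (fun z : ℝ × Y => z.1) p (pairLaw P W) := by
  have h : MeasurePreserving (Prod.fst : ℝ × Y → ℝ) (pairLaw P W) (gaussianReal 0 P) :=
    ⟨measurable_fst, Measure.fst_compProd _ _⟩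
  exact (memLp_id_gaussianReal (μ := 0) (v := P) p).comp_measurePreserving h

theorem tendsto_heldOutLen {ν : ℝ} (hν : 0 < ν) : Tendsto (heldOutLen ν) atTop atTop :=
  tendsto_nat_floor_atTop.comp (tendsto_natCast_atTop_atTop.const_mul_atTop hν)

/-! ### The outage bound -/

theorem mainTheorem5
    {Ω : Type*} [MeasurableSpace Ω] (μ : Measure Ω) [IsProbabilityMeasure μ]
    {Y : Type*} [MeasurableSpace Y]
    (P : ℝ≥0) (hP : 0 < P) (W : Kernel ℝ Y) [IsMarkovKernel W]
    -- the training data: i.i.d. input-output pairs, the data set of length `L` being the first `L`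
    (T : ℕ → Ω → ℝ × Y) (hT : ∀ i, HasLaw (T i) (pairLaw P W) μ) (hindep : iIndepFun T μ)
    (ν : ℝ) (hν0 : 0 < ν) (hν1 : ν < 1)
    (Poe : ℝ) (hPoe0 : 0 < Poe) (hPoe1 : Poe ≤ 1)
    (A : Learner Y ν)
    -- the learnt function has a finite fourth moment
    (hmom : ∀ L, ∀ᵐ ω ∂μ,
      MemLp (fun z : ℝ × Y => A.g L (learnPart ν T L ω) z.2) 4 (pairLaw P W))
    -- the held-out summands satisfy the Lindeberg condition, in probability
    (hlinY : ∀ ε : ℝ, 0 < ε → TendstoInMeasure μ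
      (fun (L : ℕ) (ω : Ω) => lindebergRatio (pairLaw P W)
        (fun z => A.g L (learnPart ν T L ω) z.2 ^ 2) (heldOutLen ν L) ε) atTop (fun _ => 0))
    (hlinXY : ∀ ε : ℝ, 0 < ε → TendstoInMeasure μ
      (fun (L : ℕ) (ω : Ω) => lindebergRatio (pairLaw P W)
        (fun z => z.1 * A.g L (learnPart ν T L ω) z.2) (heldOutLen ν L) ε) atTop (fun _ => 0)) :
    limsup (fun L : ℕ => μ {ω |
      estRate P Poe (A.g L (learnPart ν T L ω)) (A.a L (learnPart ν T L ω)) (heldOutPart ν T L ω) >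
        gmiA P W (A.g L (learnPart ν T L ω)) (A.a L (learnPart ν T L ω))}) atTop
      ≤ ENNReal.ofReal Poe := by
  set ρ := pairLaw P W with hρ
  set c := erfcInv Poe with hc
  refine ENNReal.le_of_forall_pos_le_add fun δ hδ _ => ?_
  -- These constants are fixed before L and before `g`, so the Lindeberg hypotheses are needed only
  -- at the single level `ε₀`.
  obtain ⟨ε₀, hε₀, n₀, H⟩ := exists_forall_pi_confidence_bound_le hPoe0 hPoe1
    (δ := δ / 4) (by positivity) ρ
  set τY : ℕ → Ω → ℝ := fun L ω => lindebergRatio ρ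
    (fun z => A.g L (learnPart ν T L ω) z.2 ^ 2) (heldOutLen ν L) ε₀ with hτY
  set τX : ℕ → Ω → ℝ := fun L ω => lindebergRatio ρ
    (fun z => z.1 * A.g L (learnPart ν T L ω) z.2) (heldOutLen ν L) ε₀ with hτX
  have hδ4 : (0 : ℝ≥0∞) < ENNReal.ofReal (δ / 4) := by simpa using hδ
  have hY := (tendstoInMeasure_iff_norm.1 (hlinY ε₀ hε₀) ε₀ hε₀).eventually_le_const hδ4
  have hX := (tendstoInMeasure_iff_norm.1 (hlinXY ε₀ hε₀) ε₀ hε₀).eventually_le_const hδ4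
  refine limsup_le_of_le (by isBoundedDefault) ?_
  filter_upwards [hY, hX, (tendsto_heldOutLen hν0).eventually_ge_atTop n₀] with L hYL hXL hnL
  set n := heldOutLen ν L with hn
  have hgm : ∀ t, Measurable (A.g L t) := fun t => (A.measurable_g L).comp measurable_prodMk_left
  have hg3 : Measurable fun q : (Fin (learnLen ν L) → ℝ × Y) × (ℝ × Y) => A.g L q.1 q.2.2 :=
    (A.measurable_g L).comp (measurable_fst.prodMk (measurable_snd.comp measurable_snd))
  have hx3 : Measurable fun q : (Fin (learnLen ν L) → ℝ × Y) × (ℝ × Y) => q.2.1 :=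
    measurable_fst.comp measurable_snd
  -- A measurable event containing the event of interest, whose own measurability is never needed.
  set E : Set ((Fin (learnLen ν L) → ℝ × Y) × (Fin n → ℝ × Y)) :=
    {q | q.2 ∈ confidenceFailure ρ c (fun z => A.g L q.1 z.2 ^ 2) n} ∪
    (({q | A.a L q.1 < 0} ∩
        {q | q.2 ∈ confidenceFailure ρ c (fun z => z.1 * A.g L q.1 z.2) n}) ∪
      ({q | 0 < A.a L q.1} ∩
        {q | q.2 ∈ confidenceFailure ρ c (fun z => -(z.1 * A.g L q.1 z.2)) n})) with hE
  have ha : Measurable fun q : (Fin (learnLen ν L) → ℝ × Y) × (Fin n → ℝ × Y) => A.a L q.1 :=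
    (A.measurable_a L).comp measurable_fst
  have hEm : MeasurableSet E := by
    refine (measurableSet_confidenceFailure ρ c n
      (U := fun t z => A.g L t z.2 ^ 2) (hg3.pow_const 2)).union (.union ?_ ?_)
    · exact (measurableSet_lt ha measurable_const).inter (measurableSet_confidenceFailure ρ c n
        (U := fun t z => z.1 * A.g L t z.2) (hx3.mul hg3))
    · exact (measurableSet_lt measurable_const ha).inter (measurableSet_confidenceFailure ρ c n
        (U := fun t z => -(z.1 * A.g L t z.2)) (hx3.mul hg3).neg)
  have hlearn : AEMeasurable (learnPart ν T L) μ :=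
    aemeasurable_pi_lambda _ fun i => (hT i).aemeasurable
  have hheld : AEMeasurable (heldOutPart ν T L) μ :=
    aemeasurable_pi_lambda _ fun i => (hT _).aemeasurable
  have hjoint := map_learnPart_heldOutPart hT hindep ν L
  have hfst : μ.map (learnPart ν T L) = Measure.pi fun _ : Fin (learnLen ν L) => ρ := by
    have := congrArg (Measure.map Prod.fst) hjoint
    rwa [AEMeasurable.map_map_of_aemeasurable measurable_fst.aemeasurable
      (hlearn.prodMk hheld), Measure.map_fst_prod, measure_univ, one_smul] at this
  -- conditioning on the learning part
  have hcond : μ {ω | (learnPart ν T L ω, heldOutPart ν T L ω) ∈ E}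
      = ∫⁻ ω, (Measure.pi fun _ : Fin n => ρ) (Prod.mk (learnPart ν T L ω) ⁻¹' E) ∂μ := by
    rw [← lintegral_map' (f := fun t => (Measure.pi fun _ : Fin n => ρ) (Prod.mk t ⁻¹' E))
      (measurable_measure_prodMk_left hEm).aemeasurable hlearn, hfst, ← Measure.prod_apply hEm,
      ← hjoint, Measure.map_apply_of_aemeasurable (hlearn.prodMk hheld) hEm]
    rfl
  -- On this set, of probability at most δ/2 in total, the conditional probability is bounded by 1.
  set Bad : Set Ω := {ω | ε₀ ≤ ‖τY L ω - 0‖} ∪ {ω | ε₀ ≤ ‖τX L ω - 0‖} with hBad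
  have hpoint : ∀ᵐ ω ∂μ, (Measure.pi fun _ : Fin n => ρ) (Prod.mk (learnPart ν T L ω) ⁻¹' E)
      ≤ ENNReal.ofReal (Poe + δ / 2) + Bad.indicator 1 ω := by
    filter_upwards [hmom L] with ω hω
    by_cases hb : ω ∈ Bad
    · rw [Set.indicator_of_mem hb]
      exact prob_le_one.trans (by simp)
    · rw [Set.indicator_of_notMem hb, add_zero]
      simp only [hBad, Set.mem_union, Set.mem_ofPred_eq, not_or, not_le, sub_zero] at hb
      set t := learnPart ν T L ω with ht
      have hτ1 : τY L ω ≤ ε₀ := (le_abs_self _).trans hb.1.le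
      have hτ2 : τX L ω ≤ ε₀ := (le_abs_self _).trans hb.2.le
      -- 1/4 + 1/4 = 1/2: fourth moments of g(y) and of the Gaussian input put g(y)² and x g(y) in
      -- L².
      have : ENNReal.HolderTriple 4 4 2 := ⟨by
        rw [← two_mul, show (4 : ℝ≥0∞) = 2 * 2 by norm_num, ENNReal.mul_inv (by simp) (by simp),
          ← mul_assoc, ENNReal.mul_inv_cancel (by simp) (by simp), one_mul]⟩
      have m1 : MemLp (fun z : ℝ × Y => A.g L t z.2 ^ 2) 2 ρ := by
        simpa only [sq] using hω.mul' hω (r := 2)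
      have mx : MemLp (fun z : ℝ × Y => z.1) 4 ρ := by
        simpa using memLp_fst_pairLaw P W 4
      have m2 : MemLp (fun z : ℝ × Y => z.1 * A.g L t z.2) 2 ρ :=
        hω.mul' mx (r := 2)
      have b1 := H n hnL _ ((hgm t).comp measurable_snd |>.pow_const 2) m1 hτ1
      have mm2 : Measurable fun z : ℝ × Y => z.1 * A.g L t z.2 :=
        measurable_fst.mul ((hgm t).comp measurable_snd)
      have b2 := H n hnL _ mm2 m2 hτ2
      have b3 := H n hnL _ mm2.neg m2.neg ((lindebergRatio_neg ρ _ n ε₀).trans_le hτ2)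
      have hsum : ENNReal.ofReal (Poe / 2) + ENNReal.ofReal (δ / 4) +
          (ENNReal.ofReal (Poe / 2) + ENNReal.ofReal (δ / 4)) = ENNReal.ofReal (Poe + δ / 2) := by
        rw [← ENNReal.ofReal_add (by positivity) (by positivity),
          ← ENNReal.ofReal_add (by positivity) (by positivity)]
        ring_nf
      rw [← hsum]
      -- The sign of `a` is known given the learning part and excludes one of the two events for x
      -- g(y); only two failures are summed, giving Poe rather than 3Poe/2.
      rcases lt_or_ge (A.a L t) 0 with hneg | hpos
      · refine (measure_mono ?_).trans ((measure_union_le _ _).trans (add_le_add b1 b2))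
        rintro h (h1 | ⟨_, h1⟩ | ⟨h0, _⟩)
        · exact Or.inl h1
        · exact Or.inr h1
        · exact absurd hneg (not_lt.2 (le_of_lt h0))
      · refine (measure_mono ?_).trans ((measure_union_le _ _).trans (add_le_add b1 b3))
        rintro h (h1 | ⟨h0, _⟩ | ⟨_, h1⟩)
        · exact Or.inl h1
        · exact absurd h0 (not_lt.2 hpos)
        · exact Or.inr h1
  calc μ {ω | estRate P Poe (A.g L (learnPart ν T L ω)) (A.a L (learnPart ν T L ω))
          (heldOutPart ν T L ω) > gmiA P W (A.g L (learnPart ν T L ω)) (A.a L (learnPart ν T L ω))}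
      ≤ μ {ω | (learnPart ν T L ω, heldOutPart ν T L ω) ∈ E} := measure_mono fun ω hω =>
        confidenceFailure_of_gmiA_lt_estRate hP W Poe _ _ _ hω
    _ ≤ ∫⁻ ω, (ENNReal.ofReal (Poe + δ / 2) + Bad.indicator 1 ω) ∂μ :=
        hcond.trans_le (lintegral_mono_ae hpoint)
    _ ≤ ENNReal.ofReal (Poe + δ / 2) + μ Bad := by
        rw [lintegral_add_left measurable_const, lintegral_const, measure_univ, mul_one]
        gcongr
        exact lintegral_indicator_one_le Bad
    _ ≤ ENNReal.ofReal (Poe + δ / 2) + (ENNReal.ofReal (δ / 4) + ENNReal.ofReal (δ / 4)) := by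
        gcongr
        exact (measure_union_le _ _).trans (add_le_add hYL hXL)
    _ = ENNReal.ofReal Poe + δ := by
        rw [← ENNReal.ofReal_add (by positivity) (by positivity),
          ← ENNReal.ofReal_add (by positivity) (by positivity),
          ← ENNReal.ofReal_coe_nnreal (p := δ), ← ENNReal.ofReal_add hPoe0.le δ.coe_nonneg]
        ring_nf
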